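/- Let $G$ be a finite group with identity $e$. A *packing* of $n$ non-empty subsets $\mathcal S_1,\dots,\mathcal S_n$ of $G$ is an element $(g_1,\dots,g_n)\in G^n$ such that the left-translates $g_1\mathcal S_1,\dots,g_n\mathcal S_n$ are pairwise disjoint. The family $\mathcal S_1,\dots,\mathcal S_n$ is *generic* if for every $k\ge 1$, every sequence $i_1,\dots,i_k$ of $k$ distinct elements of $\{1,\dots,n\}$ and every choice of elements $g_{i_j}\in\mathcal S_{i_j}^{-1}\mathcal S_{i_j}\setminus\{e\}$ one has $g_{i_1}g_{i_2}\cdots g_{i_k}\neq e$. **Proposition.** There exists a formal power series $U=U(x,\sigma_1,\sigma_2,\dots)\in\mathbb Z[\sigma_1,\sigma_2,\dots][[x]]$ (a power series in $x$ whose coefficients are polynomials in $\sigma_1,\sigma_2,\dots$) with the following two properties. (i) For every finite group $G$ with $N$ elements, every $n$ and every generic family $\mathcal S_1,\dots,\mathcal S_n$ of non-empty subsets of $G$, the number of packings of $\mathcal S_1,\dots,\mathcal S_n$ equals $$N^n\,U(N^{-1},\sigma_1,\sigma_2,\dots),$$ where the $\sigma_j$ are evaluated at the integers defined by $\sum_{j=0}^\infty\sigma_jt^j=\prod_{k=1}^n\bigl(1+\sharp(\mathcal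 S_k)\,t\bigr)$; in particular, the series $U(N^{-1},\sigma_1,\sigma_2,\dots)$ converges. (ii) For every $m\ge 1$, the coefficient of $x^m$ in $U$ is a polynomial of degree at most $2m$ with respect to the grading $\deg\sigma_i=i$, and it belongs to the ideal of $\mathbb Z[\sigma_1,\sigma_2,\dots]$ generated by $\sigma_{m+1},\sigma_{m+2},\dots,\sigma_{2m}$. -/

import Mathlib

open scoped Pointwise

/-- The (left-)packings of a family of subsets of a group: the tuples `(g₁, …, gₙ)` for which
the left-translates `gᵢ Sᵢ` are (pairwise) disjoint. -/
def packings {G : Type*} [Group G] {n : ℕ} (S : Fin n → Set G) : Set (Fin n → G) :=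
  {g | Pairwise fun i j => Disjoint (g i • S i) (g j • S j)}

/-- A family `S₁, …, Sₙ` of subsets of a group is generic if for every sequence
`i₁, …, iₖ` of `k ≥ 1` distinct indices and every choice of elements
`gⱼ ∈ S_{iⱼ}⁻¹ S_{iⱼ} ∖ {e}` one has `g₁ g₂ ⋯ gₖ ≠ e`. -/
def IsGeneric {G : Type*} [Group G] {n : ℕ} (S : Fin n → Set G) : Prop :=
  ∀ (k : ℕ), 1 ≤ k → ∀ (i : Fin k → Fin n), Function.Injective i →
    ∀ g : Fin k → G, (∀ j, g j ∈ ((S (i j))⁻¹ * S (i j)) \ {1}) →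
      (List.ofFn g).prod ≠ 1

/-- The numbers `σ₁, σ₂, …` of a family of finite sets, defined by
`∑ⱼ σⱼ tʲ = ∏ₖ (1 + ♯(Sₖ) t)`. -/
noncomputable def sigmaOf {G : Type*} {n : ℕ} (S : Fin n → Set G) (j : ℕ+) : ℤ :=
  (∏ k : Fin n, (1 + Polynomial.C ((S k).ncard : ℤ) * Polynomial.X)).coeff j

/-- The polynomial ring `ℤ[σ₁, σ₂, …]`. -/
abbrev SigmaRing : Type := MvPolynomial ℕ+ ℤ

/-! Write `N` for the order of the group, `x = 1/N` and `s i` for the size of the set with index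
`i`. Remove a point `p` from one set `S i`, leaving `A`. A packing of the reduced family is either a
packing of the old one, or the translate of `p` is covered by a unique point `b` of a unique `S j`.
In the second case the positions of `A` and `S j` are locked together, so that they act as the
single set `A ∪ p b⁻¹ S j`. Genericity makes this union disjoint and passes to the merged family,
and locking divides the count by `N` (`ncard_packingsOn_update`). Hence the normalised count
satisfies a recursion in the sizes alone.

That recursion is solved by a sum over set partitions, where a block of `b ≥ 2` sets of total size
`r` weighs `(-x)^(b-1) ∏ s i · (r-1)⋯(r-b+2)` and a single set weighs `1` (`packingSum_insert_succ`,
`ncard_packingsOn`).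

The coefficient of `x^m` is symmetric in the sizes and has degree at most `2m`, hence is a
polynomial in the elementary symmetric functions. Its monomials involve at most `2m` sizes, so the
polynomial found for `2m` sizes works for any number. With only `m ≥ 1` sizes the coefficient
vanishes, so every monomial in the `σ i` has a factor with `i > m`, and the degree bound forces `i ≤
2m`. -/

/-! ### Sums over set partitions -/

section PartitionSum

variable {ι ι' R R' : Type*} [DecidableEq ι] [DecidableEq ι'] [CommRing R] [CommRing R']

/-- The sum over all set partitions of `V` of the product of the weights of the blocks, computed
by choosing an element of `V` and summing over the block that contains it. -/
noncomputable def partitionSum (w : Finset ι → R) (V : Finset ι) : R :=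
  if h : V.Nonempty then
    ∑ A ∈ (V.erase h.choose).powerset,
      w (insert h.choose A) * partitionSum w (V.erase h.choose \ A)
  else 1
termination_by V.card
decreasing_by
  exact (Finset.card_le_card Finset.sdiff_subset).trans_lt
    (Finset.card_erase_lt_of_mem h.choose_spec)

theorem partitionSum_empty (w : Finset ι → R) : partitionSum w ∅ = 1 := by
  rw [partitionSum, dif_neg (by simp)]

/-- A partition sum may be expanded along the block of any element. -/
theorem partitionSum_insert (w : Finset ι → R) (V : Finset ι) :
    ∀ i ∉ V, partitionSum w (insert i V) =
      ∑ A ∈ V.powerset, w (insert i A) * partitionSum w (V \ A) := by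
  induction V using Finset.strongInduction with
  | H V ih =>
  intro i hi
  have hne : (insert i V).Nonempty := Finset.insert_nonempty i V
  rw [partitionSum, dif_pos hne]
  have hj : hne.choose ∈ insert i V := hne.choose_spec
  generalize hne.choose = j at hj
  by_cases hji : j = i
  · subst hji
    rw [Finset.erase_insert hi]
  · have hjV : j ∈ V := (Finset.mem_insert.mp hj).resolve_left hji
    obtain ⟨W, hjW, rfl⟩ : ∃ W, j ∉ W ∧ insert j W = V :=
      ⟨V.erase j, Finset.notMem_erase j V, Finset.insert_erase hjV⟩
    have hiW : i ∉ W := fun h => hi (Finset.mem_insert_of_mem h)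
    have hij : i ≠ j := fun h => hji h.symm
    have herase : (insert i (insert j W)).erase j = insert i W := by
      rw [Finset.insert_comm, Finset.erase_insert]
      simp [hji, hjW]
    -- Both expansions split according to whether `i` and `j` share a block. If they do not,
    -- expanding again along the other element gives a double sum over disjoint pairs of subsets of
    -- `W`, symmetric in `i` and `j`. If they do, the terms agree one by one.
    rw [herase, Finset.sum_powerset_insert hiW, Finset.sum_powerset_insert hjW]
    have key : ∀ a b : ι, a ∉ W →
        ∀ A ∈ W.powerset, w (insert b A) * partitionSum w (insert a W \ A) =
          ∑ B ∈ (W \ A).powerset,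
            w (insert b A) * (w (insert a B) * partitionSum w ((W \ A) \ B)) := by
      intro a b ha A hA
      have hAW := Finset.mem_powerset.mp hA
      have haA : a ∉ A := fun h => ha (hAW h)
      rw [Finset.insert_sdiff_of_notMem _ haA,
        ih (W \ A) (Finset.sdiff_subset.trans_ssubset (Finset.ssubset_insert hjW)) a
          (fun h => ha (Finset.mem_sdiff.mp h).1), Finset.mul_sum]
    congr 1
    · rw [Finset.sum_congr rfl (key i j hiW),
        Finset.sum_congr rfl (key j i hjW)]
      rw [Finset.sum_comm' (t' := W.powerset) (s' := fun B => (W \ B).powerset)]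
      · refine Finset.sum_congr rfl fun B _ => Finset.sum_congr rfl fun A _ => ?_
        rw [sdiff_sdiff_comm]
        ring
      · intro A B
        simp only [Finset.mem_powerset, Finset.subset_sdiff]
        constructor
        · rintro ⟨h1, h2, h3⟩
          exact ⟨⟨h1, h3.symm⟩, h2⟩
        · rintro ⟨⟨h1, h3⟩, h2⟩
          exact ⟨h1, h2, h3.symm⟩
    · refine Finset.sum_congr rfl fun A hA => ?_
      rw [Finset.insert_comm i j A]
      congr 2
      ext k
      simp only [Finset.mem_sdiff, Finset.mem_insert]
      by_cases hki : k = i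
      · subst hki; simp [hij, hiW]
      · by_cases hkj : k = j
        · subst hkj; simp [hjW, hki]
        · simp [hki, hkj]

theorem partitionSum_map (φ : R →+* R') (e : ι ↪ ι') (w : Finset ι → R) (w' : Finset ι' → R')
    (V : Finset ι) (h : ∀ B ⊆ V, w' (B.map e) = φ (w B)) :
    partitionSum w' (V.map e) = φ (partitionSum w V) := by
  induction V using Finset.strongInduction with
  | H V ih =>
  obtain rfl | ⟨i, hi⟩ := V.eq_empty_or_nonempty
  · simp [partitionSum_empty]
  · obtain ⟨W, hiW, rfl⟩ : ∃ W, i ∉ W ∧ insert i W = V :=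
      ⟨V.erase i, Finset.notMem_erase i V, Finset.insert_erase hi⟩
    rw [Finset.map_insert, partitionSum_insert _ _ _ (by simpa using hiW),
      partitionSum_insert _ _ _ hiW, map_sum]
    symm
    refine Finset.sum_bij (fun A _ => A.map e) ?_ ?_ ?_ ?_
    · intro A hA
      simpa using hA
    · intro A _ B _ hAB
      exact Finset.map_injective e hAB
    · intro B hB
      obtain ⟨A, hA, rfl⟩ := Finset.subset_map_iff.mp (Finset.mem_powerset.mp hB)
      exact ⟨A, Finset.mem_powerset.mpr hA, rfl⟩
    · intro A hA
      have hAW := Finset.mem_powerset.mp hA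
      rw [map_mul, ← Finset.map_sdiff, ← Finset.map_insert, h _ (Finset.insert_subset_insert i hAW),
        ih (W \ A) (Finset.sdiff_subset.trans_ssubset (Finset.ssubset_insert hiW))
          fun B hB => h B (hB.trans (Finset.sdiff_subset.trans (Finset.subset_insert i W)))]

theorem partitionSum_congr {w w' : Finset ι → R} {V : Finset ι} (h : ∀ B ⊆ V, w' B = w B) :
    partitionSum w' V = partitionSum w V := by
  simpa using partitionSum_map (RingHom.id R) (Function.Embedding.refl ι) w w' V (by simpa using h)

end PartitionSum

/-! ### Block weights and their recursion -/

section BlockWeight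

variable {ι ι' R R' : Type*} [CommRing R] [CommRing R']

/-- The total weight of the clusters with vertex set `B`, for sets of sizes `s`. -/
noncomputable def blockWeight (s : ι → R) (x : R) (B : Finset ι) : R :=
  (-x) ^ (B.card - 1) * if B.card ≤ 1 then 1 else
    (∏ i ∈ B, s i) * ∏ k ∈ Finset.range (B.card - 2), (∑ i ∈ B, s i - ((k : R) + 1))

theorem blockWeight_congr {s s' : ι → R} (x : R) {B : Finset ι} (h : ∀ i ∈ B, s' i = s i) :
    blockWeight s' x B = blockWeight s x B := by
  simp only [blockWeight, Finset.prod_congr rfl h, Finset.sum_congr rfl h]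

theorem blockWeight_singleton (s : ι → R) (x : R) (i : ι) : blockWeight s x {i} = 1 := by
  simp [blockWeight]

variable [DecidableEq ι] [DecidableEq ι']

/-- The generating polynomial of packings of generic sets of sizes `s`. -/
noncomputable def packingSum (s : ι → R) (x : R) (V : Finset ι) : R :=
  partitionSum (blockWeight s x) V

theorem packingSum_congr {s s' : ι → R} (x : R) {V : Finset ι} (h : ∀ i ∈ V, s' i = s i) :
    packingSum s' x V = packingSum s x V :=
  partitionSum_congr fun _ hB => blockWeight_congr x fun i hi => h i (hB hi)

theorem packingSum_map (φ : R →+* R') (e : ι ↪ ι') (s : ι → R) (s' : ι' → R') (x : R)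
    (V : Finset ι) (h : ∀ i ∈ V, s' (e i) = φ (s i)) :
    packingSum s' (φ x) (V.map e) = φ (packingSum s x V) := by
  refine partitionSum_map φ e _ _ V fun B hB => ?_
  have h1 : ∏ i ∈ B, s' (e i) = ∏ i ∈ B, φ (s i) :=
    Finset.prod_congr rfl fun i hi => h i (hB hi)
  have h2 : ∑ i ∈ B, s' (e i) = ∑ i ∈ B, φ (s i) :=
    Finset.sum_congr rfl fun i hi => h i (hB hi)
  simp only [blockWeight, Finset.card_map, Finset.prod_map, Finset.sum_map, h1, h2]
  split_ifs <;> simp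

theorem packingSum_hom (φ : R →+* R') (s : ι → R) (x : R) (V : Finset ι) :
    φ (packingSum s x V) = packingSum (fun i => φ (s i)) (φ x) V := by
  rw [← packingSum_map φ (Function.Embedding.refl ι) s (fun i => φ (s i)) x V (by simp)]
  simp

/-- Writing `A.card = a + 1` removes the case split and the truncated subtractions. -/
theorem blockWeight_insert (s : ι → R) (x : R) {i : ι} {A : Finset ι} (hi : i ∉ A) {a : ℕ}
    (hA : A.card = a + 1) :
    blockWeight s x (insert i A) = (-x) ^ (a + 1) * ((s i * ∏ j ∈ A, s j) *
      ∏ k ∈ Finset.range a, (s i + ∑ j ∈ A, s j - ((k : R) + 1))) := by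
  have hc : (insert i A).card = a + 2 := by rw [Finset.card_insert_of_notMem hi, hA]
  rw [blockWeight, hc, if_neg (by omega), Finset.prod_insert hi, Finset.sum_insert hi]
  simp

/-- A block of at least two elements carries the factor `s i = 0`; only the singleton block, of
weight `1`, survives. -/
theorem packingSum_insert_of_eq_zero {s : ι → R} (x : R) {i : ι} {V : Finset ι} (hi : i ∉ V)
    (hs : s i = 0) : packingSum s x (insert i V) = packingSum s x V := by
  rw [packingSum, partitionSum_insert _ _ _ hi, Finset.sum_eq_single ∅]
  · simp [blockWeight_singleton, packingSum]
  · intro A hA hne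
    obtain ⟨a, ha⟩ : ∃ a, A.card = a + 1 :=
      ⟨A.card - 1, by have := (Finset.nonempty_iff_ne_empty.mpr hne).card_pos; omega⟩
    rw [blockWeight_insert s x (fun h => hi (Finset.mem_powerset.mp hA h)) ha, hs]
    simp
  · simp

theorem packingSum_of_subset {s : ι → R} (x : R) {V W : Finset ι} (hVW : V ⊆ W)
    (hs : ∀ i ∈ W, i ∉ V → s i = 0) : packingSum s x W = packingSum s x V := by
  induction W using Finset.strongInduction with
  | H W ih =>
  obtain rfl | hne := eq_or_ne V W
  · rfl
  · obtain ⟨i, hiW, hiV⟩ := Finset.exists_of_ssubset (hVW.ssubset_of_ne hne)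
    have := packingSum_insert_of_eq_zero x (Finset.notMem_erase i W) (hs i hiW hiV)
    rw [Finset.insert_erase hiW] at this
    rw [this]
    exact ih _ (Finset.erase_ssubset hiW) (Finset.subset_erase.mpr ⟨hVW, hiV⟩)
      fun j hj => hs j (Finset.mem_of_mem_erase hj)

open Function in
-- Merging preserves the total size `c + r`, where `r` is the sum of `s` over `A`. For `A.card = a +
-- 2`, after cancelling common factors, the claim is `(c+1)(c+r) = c(c+r-a-1) + ∑ (c + s j)`, the
-- last sum being `(a+2)c + r`.
theorem blockWeight_insert_succ (s : ι → R) (x c : R) {i : ι} {A : Finset ι} (hi : i ∉ A)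
    (hs : s i = c + 1) :
    blockWeight s x (insert i A) = blockWeight (update s i c) x (insert i A) -
      x * ∑ j ∈ A, s j * blockWeight (update s i (c + s j)) x (insert i (A.erase j)) := by
  have hupd : ∀ (d : R), ∀ B ⊆ A, ∀ j ∈ B, update s i d j = s j := fun d B hB j hj =>
    update_of_ne (ne_of_mem_of_not_mem (hB hj) hi) _ _
  have hP : ∀ (d : R), ∀ B ⊆ A, ∏ j ∈ B, update s i d j = ∏ j ∈ B, s j := fun d B hB =>
    Finset.prod_congr rfl (hupd d B hB)
  have hS : ∀ (d : R), ∀ B ⊆ A, ∑ j ∈ B, update s i d j = ∑ j ∈ B, s j := fun d B hB =>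
    Finset.sum_congr rfl (hupd d B hB)
  obtain h0 | ⟨a, ha⟩ : A.card = 0 ∨ ∃ a, A.card = a + 1 := by
    cases h : A.card <;> simp
  · rw [Finset.card_eq_zero.mp h0]
    simp [blockWeight_singleton]
  rw [blockWeight_insert s x hi ha, blockWeight_insert _ x hi ha, hP _ A subset_rfl,
    hS _ A subset_rfl, update_self, hs]
  cases a with
  | zero =>
    obtain ⟨j, rfl⟩ := Finset.card_eq_one.mp ha
    simp [blockWeight_singleton]
    ring
  | succ a =>
    have hterm : ∀ j ∈ A, s j * blockWeight (update s i (c + s j)) x (insert i (A.erase j)) =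
        (-x) ^ (a + 1) * (∏ j ∈ A, s j) *
          (∏ k ∈ Finset.range a, (c + ∑ j ∈ A, s j - ((k : R) + 1))) * (c + s j) := by
      intro j hj
      have hsub : A.erase j ⊆ A := Finset.erase_subset j A
      rw [blockWeight_insert _ x (fun h => hi (hsub h))
        (show (A.erase j).card = a + 1 by rw [Finset.card_erase_of_mem hj, ha]; rfl),
        hP _ _ hsub, hS _ _ hsub, update_self, ← Finset.mul_prod_erase A s hj,
        ← Finset.add_sum_erase A s hj]
      simp only [add_assoc]
      ring
    rw [Finset.sum_congr rfl hterm, ← Finset.mul_sum, Finset.sum_add_distrib, Finset.sum_const, ha,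
      Finset.prod_range_succ', Finset.prod_range_succ]
    have hshift : ∏ k ∈ Finset.range a, (c + 1 + ∑ j ∈ A, s j - (((k + 1 : ℕ) : R) + 1)) =
        ∏ k ∈ Finset.range a, (c + ∑ j ∈ A, s j - ((k : R) + 1)) :=
      Finset.prod_congr rfl fun k _ => by push_cast; ring
    rw [hshift]
    push_cast
    simp only [nsmul_eq_mul]
    push_cast
    ring

open Function in
/-- The effect of adding one element to the set with index `i`. -/
theorem packingSum_insert_succ (s : ι → R) (x c : R) {i : ι} {V : Finset ι} (hi : i ∉ V)
    (hs : s i = c + 1) :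
    packingSum s x (insert i V) = packingSum (update s i c) x (insert i V) -
      x * ∑ j ∈ V, s j * packingSum (update s i (c + s j)) x (insert i (V.erase j)) := by
  have hupd : ∀ (d : R), ∀ B ⊆ V, packingSum (update s i d) x B = packingSum s x B := fun d B hB =>
    packingSum_congr x fun j hj => update_of_ne (ne_of_mem_of_not_mem (hB hj) hi) _ _
  have hexp : ∀ (t : ι → R) (W : Finset ι), W ⊆ V → packingSum t x (insert i W) =
      ∑ A ∈ W.powerset, blockWeight t x (insert i A) * packingSum t x (W \ A) := fun t W hW =>
    partitionSum_insert _ _ _ fun h => hi (hW h)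
  rw [hexp _ V subset_rfl, hexp _ V subset_rfl]
  -- Choosing the partner `j` and then the rest of the block of `i` amounts to choosing the block
  -- first and then `j` inside it.
  have hswap : ∑ j ∈ V, s j * packingSum (update s i (c + s j)) x (insert i (V.erase j)) =
      ∑ A ∈ V.powerset, (∑ j ∈ A, s j *
        blockWeight (update s i (c + s j)) x (insert i (A.erase j))) * packingSum s x (V \ A) := by
    simp only [Finset.sum_mul]
    rw [Finset.sum_comm' (t' := V) (s' := fun j => V.powerset.filter (j ∈ ·))]
    · refine Finset.sum_congr rfl fun j hj => ?_
      rw [hexp _ _ (Finset.erase_subset j V), Finset.mul_sum]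
      refine Finset.sum_bij' (fun A _ => insert j A) (fun A _ => A.erase j) ?_ ?_ ?_ ?_ ?_
      · intro A hA
        have := Finset.subset_erase.mp (Finset.mem_powerset.mp hA)
        simp [Finset.insert_subset_iff, hj, this.1]
      · intro A hA
        simp only [Finset.mem_filter, Finset.mem_powerset] at hA ⊢
        exact Finset.erase_subset_erase j hA.1
      · intro A hA
        exact Finset.erase_insert (Finset.subset_erase.mp (Finset.mem_powerset.mp hA)).2
      · intro A hA
        exact Finset.insert_erase (Finset.mem_filter.mp hA).2
      · intro A hA
        have hA' := Finset.subset_erase.mp (Finset.mem_powerset.mp hA)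
        rw [Finset.erase_insert hA'.2, hupd _ _ (Finset.sdiff_subset.trans (Finset.erase_subset j V)),
          mul_assoc]
        congr 3
        ext k
        simp only [Finset.mem_sdiff, Finset.mem_erase, Finset.mem_insert, not_or]
        tauto
    · intro A j
      simp only [Finset.mem_powerset, Finset.mem_filter]
      exact ⟨fun h => ⟨⟨h.1, h.2⟩, h.1 h.2⟩, fun h => h.1⟩
  rw [hswap, Finset.mul_sum, ← Finset.sum_sub_distrib]
  refine Finset.sum_congr rfl fun A hA => ?_
  have hAV := Finset.mem_powerset.mp hA
  rw [blockWeight_insert_succ s x c (fun h => hi (hAV h)) hs, hupd _ _ Finset.sdiff_subset]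
  ring

end BlockWeight

/-! ### Elementary symmetric functions -/

section ElemSymm

variable {ι ι' R R' : Type*} [CommRing R] [CommRing R']

/-- The elementary symmetric functions of the values `s k` for `k ∈ V`. -/
noncomputable def elemSymm (s : ι → R) (V : Finset ι) (j : ℕ) : R :=
  (∏ k ∈ V, (1 + Polynomial.C (s k) * Polynomial.X)).coeff j

theorem elemSymm_map (φ : R →+* R') (e : ι ↪ ι') (s : ι → R) (s' : ι' → R') (V : Finset ι)
    (h : ∀ i ∈ V, s' (e i) = φ (s i)) (j : ℕ) :
    elemSymm s' (V.map e) j = φ (elemSymm s V j) := by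
  rw [elemSymm, elemSymm, ← Polynomial.coeff_map, Polynomial.map_prod, Finset.prod_map]
  congr 1
  exact Finset.prod_congr rfl fun i hi => by simp [h i hi]

theorem elemSymm_of_subset {s : ι → R} {V W : Finset ι} (hVW : V ⊆ W)
    (hs : ∀ i ∈ W, i ∉ V → s i = 0) (j : ℕ) : elemSymm s W j = elemSymm s V j := by
  rw [elemSymm, elemSymm, Finset.prod_subset hVW fun i hi hi' => by simp [hs i hi hi']]

theorem elemSymm_eq_sum (s : ι → R) (V : Finset ι) (j : ℕ) :
    elemSymm s V j = ∑ T ∈ V.powersetCard j, ∏ k ∈ T, s k := by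
  classical
  rw [elemSymm, Finset.prod_one_add, Polynomial.finsetSum_coeff, Finset.powersetCard_eq_filter,
    Finset.sum_filter]
  refine Finset.sum_congr rfl fun T _ => ?_
  rw [Finset.prod_mul_distrib, Finset.prod_const, ← map_prod, Polynomial.coeff_C_mul_X_pow]
  simp [eq_comm]

theorem elemSymm_X (n j : ℕ) :
    elemSymm (MvPolynomial.X : Fin n → MvPolynomial (Fin n) ℤ) Finset.univ j =
      MvPolynomial.esymm (Fin n) ℤ j :=
  elemSymm_eq_sum _ _ _

theorem isHomogeneous_elemSymm_X (V : Finset ι) (j : ℕ) :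
    (elemSymm (MvPolynomial.X : ι → MvPolynomial ι ℤ) V j).IsHomogeneous j := by
  rw [elemSymm_eq_sum]
  refine MvPolynomial.IsHomogeneous.sum _ _ _ fun T hT => ?_
  have := MvPolynomial.IsHomogeneous.prod T (MvPolynomial.X : ι → MvPolynomial ι ℤ) (fun _ => 1)
    fun i _ => MvPolynomial.isHomogeneous_X ℤ i
  simpa [(Finset.mem_powersetCard.mp hT).2] using this

end ElemSymm

/-! ### Coefficients in `x` and their degrees -/

open MvPolynomial in
-- The product of the sizes has degree `b` and there are `b - 2` linear factors, where `b ≥ 2` is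
-- the block size: `b + (b - 2) = 2(b - 1)`. This is the source of the bound `2m`.
theorem totalDegree_blockWeight_le {ι : Type*} (B : Finset ι) :
    (blockWeight (X : ι → MvPolynomial ι ℤ) 1 B).totalDegree ≤ 2 * (B.card - 1) := by
  have hneg : ((-1 : MvPolynomial ι ℤ) ^ (B.card - 1)).totalDegree = 0 := by
    obtain h | h := neg_one_pow_eq_or (MvPolynomial ι ℤ) (B.card - 1) <;> rw [h] <;> simp
  rw [blockWeight]
  refine (totalDegree_mul _ _).trans ?_
  rw [hneg, zero_add]
  split_ifs with hB
  · simp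
  · refine (totalDegree_mul _ _).trans ?_
    have h1 : (∏ i ∈ B, (X i : MvPolynomial ι ℤ)).totalDegree ≤ B.card := by
      refine (totalDegree_finsetProd _ _).trans ?_
      simp
    have h2 : (∏ k ∈ Finset.range (B.card - 2),
        (∑ i ∈ B, (X i : MvPolynomial ι ℤ) - ((k : MvPolynomial ι ℤ) + 1))).totalDegree ≤
          B.card - 2 := by
      refine (totalDegree_finsetProd _ _).trans ?_
      refine (Finset.sum_le_card_nsmul _ _ 1 fun k _ => ?_).trans (by simp)
      refine (totalDegree_sub _ _).trans (max_le ?_ ?_)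
      · exact totalDegree_finsetSum_le fun i _ => by simp
      · rw [show ((k : MvPolynomial ι ℤ) + 1) = C ((k : ℤ) + 1) by simp, totalDegree_C]
        simp
    omega

/-- Each block contributes to a single power of `x`, so a partition of `V` contributes in degree
`V.card` minus the number of its blocks. -/
theorem blockWeight_X_eq {ι R : Type*} [CommRing R] (s : ι → R) (B : Finset ι) :
    blockWeight (fun i => Polynomial.C (s i)) Polynomial.X B =
      Polynomial.C (blockWeight s 1 B) * Polynomial.X ^ (B.card - 1) := by
  rw [blockWeight, blockWeight, neg_pow (Polynomial.X : Polynomial R)]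
  split_ifs <;> simp
  ring

section PackingCoeff

variable {ι ι' R R' : Type*} [CommRing R] [CommRing R'] [DecidableEq ι] [DecidableEq ι']

/-- The coefficient of `x ^ m` in `packingSum s x V`. -/
noncomputable def packingCoeff (s : ι → R) (V : Finset ι) (m : ℕ) : R :=
  (packingSum (fun i => Polynomial.C (s i)) Polynomial.X V).coeff m

theorem packingCoeff_map (φ : R →+* R') (e : ι ↪ ι') (s : ι → R) (s' : ι' → R') (V : Finset ι)
    (h : ∀ i ∈ V, s' (e i) = φ (s i)) (m : ℕ) :
    packingCoeff s' (V.map e) m = φ (packingCoeff s V m) := by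
  rw [packingCoeff, packingCoeff, ← Polynomial.coeff_map, ← Polynomial.coe_mapRingHom,
    ← packingSum_map (Polynomial.mapRingHom φ) e _ (fun i => Polynomial.C (s' i)) _ V
      fun i hi => by simp [h i hi]]
  simp

theorem packingCoeff_of_subset {s : ι → R} {V W : Finset ι} (hVW : V ⊆ W)
    (hs : ∀ i ∈ W, i ∉ V → s i = 0) (m : ℕ) : packingCoeff s W m = packingCoeff s V m := by
  rw [packingCoeff, packingCoeff,
    packingSum_of_subset Polynomial.X hVW fun i hi hi' => by simp [hs i hi hi']]

theorem hasSum_packingCoeff (s : ι → ℤ) (V : Finset ι) (x : ℝ) :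
    HasSum (fun m => ((packingCoeff s V m : ℤ) : ℝ) * x ^ m)
      (packingSum (fun i => (s i : ℝ)) x V) := by
  have h := packingSum_hom (Polynomial.eval₂RingHom (Int.castRingHom ℝ) x)
    (fun i => Polynomial.C (s i)) Polynomial.X V
  simp only [Polynomial.coe_eval₂RingHom, Polynomial.eval₂_C, Polynomial.eval₂_X] at h
  simp only [Int.coe_castRingHom] at h
  rw [← h, Polynomial.eval₂_eq_sum_range]
  refine hasSum_sum_of_ne_finset_zero fun m hm => ?_
  rw [packingCoeff, Polynomial.coeff_eq_zero_of_natDegree_lt (by simpa [Nat.lt_succ_iff] using hm)]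
  simp

/-- A partition of a nonempty `V` has at least one block, so the degree in `x` is at most `V.card -
1`. -/
theorem packingCoeff_eq_zero_of_card_le (s : ι → R) (V : Finset ι) {m : ℕ} (hm : 1 ≤ m)
    (hV : V.card ≤ m) : packingCoeff s V m = 0 := by
  have key : ∀ V : Finset ι,
      (packingSum (fun i => Polynomial.C (s i)) Polynomial.X V).natDegree ≤ V.card - 1 := by
    intro V
    induction V using Finset.strongInduction with
    | H V ih =>
    obtain rfl | ⟨i, hi⟩ := V.eq_empty_or_nonempty
    · simp [packingSum, partitionSum_empty]
    · obtain ⟨W, hiW, rfl⟩ : ∃ W, i ∉ W ∧ insert i W = V :=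
        ⟨V.erase i, Finset.notMem_erase i V, Finset.insert_erase hi⟩
      rw [packingSum, partitionSum_insert _ _ _ hiW, Finset.card_insert_of_notMem hiW]
      refine Polynomial.natDegree_sum_le_of_forall_le _ _ fun A hA => ?_
      have hAW := Finset.mem_powerset.mp hA
      refine Polynomial.natDegree_mul_le.trans ?_
      have h1 := ih (W \ A) (Finset.sdiff_subset.trans_ssubset (Finset.ssubset_insert hiW))
      rw [packingSum] at h1
      rw [blockWeight_X_eq]
      have h2 := Polynomial.natDegree_C_mul_X_pow_le (blockWeight s 1 (insert i A))
        ((insert i A).card - 1)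
      rw [Finset.card_insert_of_notMem fun h => hiW (hAW h)] at h2 ⊢
      have h3 := Finset.card_sdiff_add_card_eq_card hAW
      omega
  exact Polynomial.coeff_eq_zero_of_natDegree_lt ((key V).trans_lt (by omega))

open MvPolynomial in
theorem totalDegree_packingCoeff_le (V : Finset ι) (m : ℕ) :
    (packingCoeff (X : ι → MvPolynomial ι ℤ) V m).totalDegree ≤ 2 * m := by
  induction V using Finset.strongInduction generalizing m with
  | H V ih =>
  obtain rfl | ⟨i, hi⟩ := V.eq_empty_or_nonempty
  · rw [packingCoeff, packingSum, partitionSum_empty, Polynomial.coeff_one]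
    split_ifs <;> simp
  · obtain ⟨W, hiW, rfl⟩ : ∃ W, i ∉ W ∧ insert i W = V :=
      ⟨V.erase i, Finset.notMem_erase i V, Finset.insert_erase hi⟩
    rw [packingCoeff, packingSum, partitionSum_insert _ _ _ hiW, Polynomial.finsetSum_coeff]
    refine totalDegree_finsetSum_le fun A _ => ?_
    rw [Polynomial.coeff_mul]
    refine totalDegree_finsetSum_le fun ab hab => (totalDegree_mul _ _).trans ?_
    rw [Finset.HasAntidiagonal.mem_antidiagonal] at hab
    have h1 := ih (W \ A) (Finset.sdiff_subset.trans_ssubset (Finset.ssubset_insert hiW)) ab.2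
    rw [packingCoeff, packingSum] at h1
    have h2 : ((blockWeight (fun i => Polynomial.C (X i : MvPolynomial ι ℤ)) Polynomial.X
        (insert i A)).coeff ab.1).totalDegree ≤ 2 * ab.1 := by
      rw [blockWeight_X_eq, Polynomial.coeff_C_mul_X_pow]
      split_ifs with h
      · rw [h]
        exact totalDegree_blockWeight_le _
      · simp
    omega

end PackingCoeff

/-! ### Universal polynomials in the `σ i` -/

section Universal

open MvPolynomial

/-- The polynomial `p` computes the `m`-th packing coefficient of the sizes `s`, for indices
in `V`, from their elementary symmetric functions. -/
def Computes {ι R : Type*} [CommRing R] [DecidableEq ι] (p : SigmaRing) (m : ℕ) (s : ι → R)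
    (V : Finset ι) : Prop :=
  aeval (fun j : ℕ+ => elemSymm s V j) p = packingCoeff s V m

namespace Computes

variable {ι ι' R R' : Type*} [CommRing R] [CommRing R'] [DecidableEq ι] [DecidableEq ι']
  {p : SigmaRing} {m : ℕ}

theorem map {s : ι → R} {V : Finset ι} (hp : Computes p m s V) (φ : R →+* R') (e : ι ↪ ι')
    {s' : ι' → R'} (h : ∀ i ∈ V, s' (e i) = φ (s i)) : Computes p m s' (V.map e) := by
  rw [Computes] at hp ⊢
  rw [packingCoeff_map φ e s s' V h, ← hp]
  simp only [elemSymm_map φ e s s' V h]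
  exact (comp_aeval_apply _ φ.toIntAlgHom p).symm

theorem of_map {s : ι → R} {V : Finset ι} (e : ι ↪ ι') {s' : ι' → R}
    (h : ∀ i ∈ V, s' (e i) = s i) (hp : Computes p m s' (V.map e)) : Computes p m s V := by
  rw [Computes] at hp ⊢
  rw [packingCoeff_map (RingHom.id R) e s s' V h] at hp
  simp only [elemSymm_map (RingHom.id R) e s s' V h] at hp
  exact hp

theorem iff_of_subset {s : ι → R} {V W : Finset ι} (hVW : V ⊆ W)
    (hs : ∀ i ∈ W, i ∉ V → s i = 0) : Computes p m s W ↔ Computes p m s V := by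
  simp only [Computes, packingCoeff_of_subset hVW hs, elemSymm_of_subset hVW hs]

/-- A polynomial that computes the coefficient for `n` indeterminates does so for all sizes of
which at most `n` are nonzero. -/
theorem of_card_le {n : ℕ} (hp : Computes p m (X : Fin n → MvPolynomial (Fin n) ℤ) Finset.univ)
    (s : ι → R) {T W : Finset ι} (hTW : T ⊆ W) (hs : ∀ i ∈ W, i ∉ T → s i = 0)
    (hT : T.card ≤ n) : Computes p m s W := by
  rw [iff_of_subset hTW hs]
  obtain ⟨e⟩ : Nonempty (T ↪ Fin n) := Function.Embedding.nonempty_of_card_le (by simpa using hT)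
  -- The sizes in `T` are carried into `Fin n` and padded with zeros, which change neither the
  -- elementary symmetric functions nor the packing coefficient.
  set s' : Fin n → R := Function.extend e (fun i : T => s i) 0 with hs'
  have h1 : Computes p m s' Finset.univ := by
    simpa using hp.map (aeval s').toRingHom (Function.Embedding.refl _) (s' := s') (by simp)
  have h2 : Computes p m (fun i : T => s i) Finset.univ := by
    refine of_map e (s' := s') (fun i _ => e.injective.extend_apply _ _ i) ?_
    refine (iff_of_subset (Finset.subset_univ _) fun i _ hi => ?_).mp h1
    rw [hs', Function.extend_apply']
    · rfl
    · rintro ⟨j, rfl⟩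
      exact hi (by simp)
  have h3 := h2.map (RingHom.id R) (Function.Embedding.subtype (· ∈ T)) (s' := s) (by simp)
  rwa [← Finset.attach_eq_univ, Finset.attach_map_val] at h3

end Computes

theorem isHomogeneous_aeval_of_isWeightedHomogeneous {ι σ : Type*} {w : σ → ℕ}
    {g : σ → MvPolynomial ι ℤ} (hg : ∀ j, (g j).IsHomogeneous (w j)) {p : MvPolynomial σ ℤ} {k : ℕ}
    (hp : p.IsWeightedHomogeneous w k) : (aeval g p).IsHomogeneous k := by
  rw [p.as_sum, map_sum]
  refine IsHomogeneous.sum _ _ _ fun d hd => ?_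
  rw [aeval_monomial, ← hp (mem_support_iff.mp hd)]
  have h1 : (∏ j ∈ d.support, g j ^ d j).IsHomogeneous (∑ j ∈ d.support, w j * d j) :=
    IsHomogeneous.prod _ _ _ fun j _ => (hg j).pow (d j)
  have h2 : Finsupp.weight w d = 0 + ∑ j ∈ d.support, w j * d j := by
    simp [Finsupp.weight_apply, Finsupp.sum, mul_comm]
  rw [h2]
  refine IsHomogeneous.mul ?_ h1
  exact isHomogeneous_C ι (coeff d p)

theorem totalDegree_aeval_le {ι σ : Type*} {w : σ → ℕ}
    {g : σ → MvPolynomial ι ℤ} (hg : ∀ j, (g j).IsHomogeneous (w j)) {p : MvPolynomial σ ℤ} {k : ℕ}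
    (hp : weightedTotalDegree w p ≤ k) : (aeval g p).totalDegree ≤ k := by
  rw [p.as_sum, map_sum]
  refine totalDegree_finsetSum_le fun d hd => ?_
  exact (isHomogeneous_aeval_of_isWeightedHomogeneous hg
    (isWeightedHomogeneous_monomial w d _ rfl)).totalDegree_le.trans
      ((le_weightedTotalDegree w hd).trans hp)

/-- Truncating a polynomial in weighted variables does not change its value under a graded
substitution, if that value has small degree. -/
theorem exists_weightedTotalDegree_le {ι σ : Type*} {w : σ → ℕ}
    {g : σ → MvPolynomial ι ℤ} (hg : ∀ j, (g j).IsHomogeneous (w j)) (p : MvPolynomial σ ℤ) {k : ℕ}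
    (hp : (aeval g p).totalDegree ≤ k) :
    ∃ q : MvPolynomial σ ℤ, weightedTotalDegree w q ≤ k ∧ aeval g q = aeval g p := by
  classical
  set q := ∑ d ∈ p.support with Finsupp.weight w d ≤ k, monomial d (coeff d p) with hq
  set r := ∑ d ∈ p.support with ¬ Finsupp.weight w d ≤ k, monomial d (coeff d p) with hr
  have hqr : q + r = p := by
    rw [hq, hr, Finset.sum_filter_add_sum_filter_not, ← p.as_sum]
  have hqk : weightedTotalDegree w q ≤ k := by
    refine Finset.sup_le fun d hd => ?_
    rw [mem_support_iff, hq, coeff_sum] at hd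
    obtain ⟨d', hd', hne⟩ := Finset.exists_ne_zero_of_sum_ne_zero hd
    rw [coeff_monomial] at hne
    obtain rfl : d' = d := by
      by_contra h
      simp [h] at hne
    exact (Finset.mem_filter.mp hd').2
  refine ⟨q, hqk, ?_⟩
  have hsum : aeval g q + aeval g r = aeval g p := by rw [← map_add, hqr]
  -- The image of `r` lives in degrees above `k`, while those of `p` and `q` live in degrees at most
  -- `k`.
  have hr0 : aeval g r = 0 := by
    ext d
    rw [coeff_zero]
    by_cases hd : d.degree ≤ k
    · rw [hr, map_sum, coeff_sum]
      refine Finset.sum_eq_zero fun d' hd' => ?_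
      refine (isHomogeneous_aeval_of_isWeightedHomogeneous hg
        (isWeightedHomogeneous_monomial w d' _ rfl)).coeff_eq_zero ?_
      have := (Finset.mem_filter.mp hd').2
      omega
    · have hlt : k < ∑ i ∈ d.support, d i := by
        exact not_le.mp hd
      have h1 := coeff_eq_zero_of_totalDegree_lt (hp.trans_lt hlt)
      have h2 := coeff_eq_zero_of_totalDegree_lt ((totalDegree_aeval_le hg hqk).trans_lt hlt)
      rw [← hsum, coeff_add, h2, zero_add] at h1
      exact h1
  rw [← hsum, hr0, add_zero]

theorem isSymmetric_packingCoeff (n m : ℕ) :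
    (packingCoeff (X : Fin n → MvPolynomial (Fin n) ℤ) Finset.univ m).IsSymmetric := by
  intro e
  have := packingCoeff_map (rename e : MvPolynomial (Fin n) ℤ →ₐ[ℤ] _).toRingHom e.toEmbedding
    X X Finset.univ (by simp) m
  simpa using this.symm

/-- The fundamental theorem of symmetric polynomials supplies a polynomial, and truncation its
degree bound. -/
theorem exists_computes_X (n m : ℕ) : ∃ p : SigmaRing,
    weightedTotalDegree (fun i : ℕ+ => (i : ℕ)) p ≤ 2 * m ∧
      Computes p m (X : Fin n → MvPolynomial (Fin n) ℤ) Finset.univ := by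
  obtain ⟨q, hq⟩ := (esymmAlgHom_fin_bijective ℤ n).2
    ⟨_, isSymmetric_packingCoeff n m⟩
  have hq' : aeval (fun i : Fin n => esymm (Fin n) ℤ (i + 1)) q =
      packingCoeff (X : Fin n → MvPolynomial (Fin n) ℤ) Finset.univ m := by
    rw [← esymmAlgHom_apply, hq]
  have hval : aeval (fun j : ℕ+ => elemSymm (X : Fin n → MvPolynomial (Fin n) ℤ) Finset.univ j)
      (rename (fun i : Fin n => Nat.succPNat i) q) =
      packingCoeff (X : Fin n → MvPolynomial (Fin n) ℤ) Finset.univ m := by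
    rw [aeval_rename, ← hq']
    congr 2
    ext1 i
    simp [elemSymm_X]
  obtain ⟨p, hp, hpq⟩ := exists_weightedTotalDegree_le (w := fun i : ℕ+ => (i : ℕ))
    (fun j => isHomogeneous_elemSymm_X (ι := Fin n) Finset.univ j) _
    (hval ▸ totalDegree_packingCoeff_le (Finset.univ : Finset (Fin n)) m)
  exact ⟨p, hp, hpq.trans hval⟩

theorem Computes.map_sub_eq_zero {ι R : Type*} [CommRing R] [DecidableEq ι] {p : SigmaRing}
    {m : ℕ} {V : Finset ι} (φ : MvPolynomial ι ℤ →+* R)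
    (hp : Computes p m (fun i => φ (X i)) V) :
    φ (aeval (fun j : ℕ+ => elemSymm (X : ι → MvPolynomial ι ℤ) V j) p - packingCoeff X V m) = 0 := by
  have h1 := packingCoeff_map φ (Function.Embedding.refl _) X (fun i => φ (X i)) V
    (fun _ _ => rfl) m
  have h2 := elemSymm_map φ (Function.Embedding.refl _) X (fun i => φ (X i)) V
    (fun _ _ => rfl)
  rw [Finset.map_refl] at h1 h2
  rw [Computes, h1] at hp
  simp only [h2] at hp
  rw [map_sub, sub_eq_zero, ← hp]
  exact comp_aeval_apply _ φ.toIntAlgHom p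

/-- The difference `D` of the two sides has degree at most `2 * m`, so any monomial in it involves
at most `2 * m` variables. Killing the other variables keeps the coefficient of that monomial and
reduces to the known case. -/
theorem Computes.of_weightedTotalDegree_le {p : SigmaRing} {m : ℕ}
    (hp : Computes p m (X : Fin (2 * m) → MvPolynomial (Fin (2 * m)) ℤ) Finset.univ)
    (hdeg : weightedTotalDegree (fun i : ℕ+ => (i : ℕ)) p ≤ 2 * m) (n : ℕ) :
    Computes p m (X : Fin n → MvPolynomial (Fin n) ℤ) Finset.univ := by
  refine sub_eq_zero.mp ?_
  obtain ⟨D, hD⟩ : ∃ D, aeval (fun j : ℕ+ => elemSymm (X : Fin n → MvPolynomial (Fin n) ℤ) Finset.univ j) p -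
    packingCoeff (X : Fin n → MvPolynomial (Fin n) ℤ) Finset.univ m = D := ⟨_, rfl⟩
  refine hD.trans ?_
  have hDdeg : D.totalDegree ≤ 2 * m := by
    rw [← hD]
    refine (totalDegree_sub _ _).trans (max_le ?_ (totalDegree_packingCoeff_le _ m))
    exact totalDegree_aeval_le (fun j : ℕ+ => isHomogeneous_elemSymm_X Finset.univ (j : ℕ)) hdeg
  ext d
  rw [coeff_zero]
  by_cases hd : ∑ i ∈ d.support, d i ≤ 2 * m
  · have hcard : d.support.card ≤ 2 * m := by
      refine le_trans ?_ hd
      rw [Finset.card_eq_sum_ones]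
      exact Finset.sum_le_sum fun i hi => Nat.one_le_iff_ne_zero.mpr (Finsupp.mem_support_iff.mp hi)
    have hinj : Function.Injective (Subtype.val : d.support → Fin n) := Subtype.val_injective
    have hκD : killCompl hinj D = 0 := by
      rw [← hD]
      refine Computes.map_sub_eq_zero (killCompl hinj).toRingHom (hp.of_card_le _ (Finset.subset_univ d.support)
        (fun i _ hi => ?_) hcard)
      refine (aeval_X _ i).trans (dif_neg ?_)
      rintro ⟨j, rfl⟩
      exact hi j.2
    have hdT : d = (d.comapDomain Subtype.val hinj.injOn).mapDomain Subtype.val := by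
      refine (Finsupp.mapDomain_comapDomain _ hinj d ?_).symm
      exact Subtype.range_coe.symm.subset
    rw [hdT, ← coeff_killCompl hinj, hκD, coeff_zero]
  · exact coeff_eq_zero_of_totalDegree_lt (hDdeg.trans_lt (by omega))

theorem Computes.mem_span {p : SigmaRing} {m : ℕ} (hm : 1 ≤ m)
    (hp : Computes p m (X : Fin m → MvPolynomial (Fin m) ℤ) Finset.univ)
    (hdeg : weightedTotalDegree (fun i : ℕ+ => (i : ℕ)) p ≤ 2 * m) :
    p ∈ Ideal.span {q : SigmaRing | ∃ i : ℕ+, m + 1 ≤ (i : ℕ) ∧ (i : ℕ) ≤ 2 * m ∧ q = X i} := by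
  have hset : {q : SigmaRing | ∃ i : ℕ+, m + 1 ≤ (i : ℕ) ∧ (i : ℕ) ≤ 2 * m ∧ q = X i} =
      X '' {i : ℕ+ | m + 1 ≤ (i : ℕ) ∧ (i : ℕ) ≤ 2 * m} := by
    ext q
    simp only [Set.mem_ofPred_eq, Set.mem_image]
    exact ⟨fun ⟨i, h1, h2, h3⟩ => ⟨i, ⟨h1, h2⟩, h3.symm⟩, fun ⟨i, ⟨h1, h2⟩, h3⟩ =>
      ⟨i, h1, h2, h3.symm⟩⟩
  rw [hset, mem_ideal_span_X_image]
  intro d hd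
  by_contra! hcon
  -- Indices in `m+1, …, 2m` are excluded by `hcon`, larger ones by the weighted degree.
  have hle : ∀ i ∈ d.support, (i : ℕ) ≤ m := by
    intro i hi
    by_contra hlt
    refine Finsupp.mem_support_iff.mp hi (hcon i ⟨by omega, ?_⟩)
    refine le_trans ?_ ((le_weightedTotalDegree _ hd).trans hdeg)
    exact Finsupp.le_weight_of_ne_zero' _ (Finsupp.mem_support_iff.mp hi)
  have hinj : Function.Injective (fun i : Fin m => Nat.succPNat i) := fun i j h =>
    Fin.ext (Nat.succPNat_injective h)
  -- For `m` indeterminates the elementary symmetric functions of index above `m` vanish, and so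
  -- does the packing coefficient; the remaining ones are algebraically independent.
  have hkill : killCompl hinj p = 0 := by
    apply esymmAlgHom_fin_injective ℤ le_rfl
    rw [map_zero]
    apply Subtype.ext
    rw [esymmAlgHom_apply, killCompl, ← AlgHom.comp_apply, comp_aeval]
    rw [Computes, packingCoeff_eq_zero_of_card_le _ _ hm (by simp)] at hp
    refine Eq.trans ?_ hp
    congr 2
    ext1 j
    split_ifs with hj
    · obtain ⟨i, rfl⟩ := hj
      rw [Equiv.ofInjective_symm_apply, aeval_X, elemSymm_X]
      simp
    · rw [map_zero, elemSymm_eq_sum, Finset.powersetCard_eq_empty.mpr, Finset.sum_empty]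
      by_contra hlt
      refine hj ⟨⟨j.natPred, ?_⟩, ?_⟩
      · have := j.natPred_add_one
        simp at hlt
        omega
      · simp
  refine mem_support_iff.mp hd ?_
  have hdm : d = (d.comapDomain _ hinj.injOn).mapDomain (fun i : Fin m => Nat.succPNat i) := by
    refine (Finsupp.mapDomain_comapDomain _ hinj d fun i hi => ?_).symm
    refine ⟨⟨i.natPred, ?_⟩, by simp⟩
    have := i.natPred_add_one
    have := hle i hi
    omega
  rw [hdm, ← coeff_killCompl hinj, hkill, coeff_zero]

/-- The coefficients of the universal packing series. -/
theorem exists_packing_polynomial (m : ℕ) : ∃ p : SigmaRing,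
    (∀ (n : ℕ) (s : Fin n → ℤ), eval (fun j : ℕ+ => elemSymm s Finset.univ j) p =
      packingCoeff s Finset.univ m) ∧
    (1 ≤ m → weightedTotalDegree (fun i : ℕ+ => (i : ℕ)) p ≤ 2 * m ∧
      p ∈ Ideal.span {q : SigmaRing |
        ∃ i : ℕ+, m + 1 ≤ (i : ℕ) ∧ (i : ℕ) ≤ 2 * m ∧ q = X i}) := by
  obtain ⟨p, hdeg, hp⟩ := exists_computes_X (2 * m) m
  refine ⟨p, fun n s => ?_, fun hm =>
    ⟨hdeg, (hp.of_weightedTotalDegree_le hdeg m).mem_span hm hdeg⟩⟩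
  have := (hp.of_weightedTotalDegree_le hdeg n).map (aeval s).toRingHom
    (Function.Embedding.refl _) (s' := s) (by simp)
  rw [Finset.map_refl, Computes] at this
  exact this

end Universal

/-! ### Genericity and merging -/

section GenericOn

variable {ι G : Type*} [Group G]

/-- Genericity of the subfamily of `S` with indices in `V`. -/
def GenericOn (V : Finset ι) (S : ι → Set G) : Prop :=
  ∀ l : List (ι × G), l ≠ [] → (l.map Prod.fst).Nodup →
    (∀ q ∈ l, q.1 ∈ V ∧ q.2 ∈ ((S q.1)⁻¹ * S q.1) \ {1}) → (l.map Prod.snd).prod ≠ 1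

theorem GenericOn.mono {V W : Finset ι} {S T : ι → Set G} (h : GenericOn W T) (hVW : V ⊆ W)
    (hST : ∀ i ∈ V, S i ⊆ T i) : GenericOn V S := fun l hl hnd hq =>
  h l hl hnd fun q hql => ⟨hVW (hq q hql).1,
    Set.mul_subset_mul (Set.inv_subset_inv.mpr (hST _ (hq q hql).1)) (hST _ (hq q hql).1)
      (hq q hql).2.1, (hq q hql).2.2⟩

theorem inv_mul_mem_inv_mul {s : Set G} {x y : G} (hx : x ∈ s) (hy : y ∈ s) :
    x⁻¹ * y ∈ s⁻¹ * s :=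
  Set.mul_mem_mul (Set.inv_mem_inv.mpr hx) hy

/-- Genericity speaks only of nontrivial letters, so a trivial factor must be dropped from the word.
-/
theorem exists_list_prod_eq {S : ι → Set G} {i j : ι} (hij : i ≠ j) {x y : G}
    (hx : x ∈ (S i)⁻¹ * S i) (hy : y ∈ (S j)⁻¹ * S j) (hxy : x * y ≠ 1) :
    ∃ l : List (ι × G), l ≠ [] ∧ (l.map Prod.fst).Nodup ∧
      (∀ q ∈ l, (q.1 = i ∨ q.1 = j) ∧ q.2 ∈ ((S q.1)⁻¹ * S q.1) \ {1}) ∧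
      (l.map Prod.snd).prod = x * y := by
  by_cases hx1 : x = 1
  · subst hx1
    exact ⟨[(j, y)], by simp, by simp, by simpa [hy] using hxy, by simp⟩
  by_cases hy1 : y = 1
  · subst hy1
    exact ⟨[(i, x)], by simp, by simp, by simpa [hx] using hxy, by simp⟩
  · exact ⟨[(i, x), (j, y)], by simp, by simp [hij], by simp [hx, hy, hx1, hy1], by simp⟩

/-- A common point `x = p * b⁻¹ * y` gives `(x⁻¹ * p) * (b⁻¹ * y) = 1`, with `x⁻¹ * p ≠ 1` because
`p ∉ A`: a word forbidden by genericity. -/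
theorem GenericOn.disjoint {V : Finset ι} {S : ι → Set G} {i j : ι} (hi : i ∈ V) (hj : j ∈ V)
    (hij : i ≠ j) (h : GenericOn V S) {A : Set G} {p b : G} (hA : A ⊆ S i) (hp : p ∈ S i)
    (hpA : p ∉ A) (hb : b ∈ S j) : Disjoint A ((p * b⁻¹) • S j) := by
  rw [Set.disjoint_left]
  rintro x hx ⟨y, hy, hxy⟩
  have hxy' : p * b⁻¹ * y = x := hxy
  have hpx : x⁻¹ * p ≠ 1 := fun he => hpA (by rwa [← inv_mul_eq_one.mp he])
  have hprod : (x⁻¹ * p) * (b⁻¹ * y) = 1 := by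
    rw [← hxy']
    group
  have hby : b⁻¹ * y ≠ 1 := fun he => hpx (by rwa [he, mul_one] at hprod)
  refine h [(i, x⁻¹ * p), (j, b⁻¹ * y)] (by simp) (by simp [hij]) ?_ (by simpa using hprod)
  simp only [List.mem_cons, List.not_mem_nil, or_false, forall_eq_or_imp, forall_eq]
  exact ⟨⟨hi, inv_mul_mem_inv_mul (hA hx) hp, hpx⟩, ⟨hj, inv_mul_mem_inv_mul hb hy, hby⟩⟩

variable [DecidableEq ι]

/-- Merging two sets that share a point preserves genericity. -/
theorem GenericOn.merge {V : Finset ι} {S : ι → Set G} {i j : ι} (hi : i ∉ V) (hj : j ∈ V)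
    (h : GenericOn (insert i V) S) {A : Set G} {p b : G} (hA : A ⊆ S i) (hp : p ∈ S i)
    (hb : b ∈ S j) :
    GenericOn (insert i (V.erase j)) (Function.update S i (A ∪ (p * b⁻¹) • S j)) := by
  have hij : i ≠ j := fun h => hi (h ▸ hj)
  have hsub : insert i (V.erase j) ⊆ insert i V :=
    Finset.insert_subset_insert i (Finset.erase_subset j V)
  have hmem : ∀ q : ι × G, q.1 ≠ i →
      (q.1 ∈ insert i (V.erase j) ∧ q.2 ∈ ((Function.update S i (A ∪ (p * b⁻¹) • S j) q.1)⁻¹ *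
        Function.update S i (A ∪ (p * b⁻¹) • S j) q.1) \ {1}) →
      (q.1 ∈ insert i V ∧ q.2 ∈ ((S q.1)⁻¹ * S q.1) \ {1}) := by
    rintro q hq ⟨h1, h2⟩
    rw [Function.update_of_ne hq] at h2
    exact ⟨hsub h1, h2⟩
  intro l hl hnd hq
  by_cases hil : i ∈ l.map Prod.fst
  · obtain ⟨⟨i', z⟩, hzl, rfl⟩ := List.mem_map.mp hil
    obtain ⟨l₁, l₂, rfl⟩ := List.append_of_mem hzl
    simp only at *
    have hz := (hq (i', z) (by simp)).2
    simp only [Function.update_self] at hz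
    -- A nontrivial difference in the merged set is a word using each of `i'` and `j` at most once:
    -- insert `p` and `b` between points of different parts, or a trivial difference if both lie in
    -- the same part. Substituting this word into `l` gives a forbidden word for `S`.
    have hm : ∃ m : List (ι × G), m ≠ [] ∧ (m.map Prod.fst).Nodup ∧
        (∀ q ∈ m, (q.1 = i' ∨ q.1 = j) ∧ q.2 ∈ ((S q.1)⁻¹ * S q.1) \ {1}) ∧
        (m.map Prod.snd).prod = z := by
      obtain ⟨⟨u, hu, v, hv, rfl⟩, hz1⟩ := hz
      have hz1' : u * v ≠ 1 := hz1
      rw [Set.mem_inv] at hu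
      obtain ⟨u, rfl⟩ : ∃ u', u'⁻¹ = u := ⟨u⁻¹, inv_inv u⟩
      rw [inv_inv] at hu
      rcases hu with hu | ⟨y, hy, rfl⟩ <;> rcases hv with hv | ⟨y', hy', rfl⟩
      · have := exists_list_prod_eq (S := S) hij (inv_mul_mem_inv_mul (hA hu) (hA hv))
          (inv_mul_mem_inv_mul hb hb) (by simpa using hz1')
        simpa using this
      · have hprod : (u⁻¹ * p) * (b⁻¹ * y') = u⁻¹ * ((p * b⁻¹) • y') := by
          simp [mul_assoc]
        have := exists_list_prod_eq (S := S) hij (inv_mul_mem_inv_mul (hA hu) hp)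
          (inv_mul_mem_inv_mul hb hy') (by rw [hprod]; exact hz1')
        rwa [hprod] at this
      · have hprod : (y⁻¹ * b) * (p⁻¹ * v) = ((p * b⁻¹) • y)⁻¹ * v := by
          simp [mul_assoc]
        have := exists_list_prod_eq (S := S) hij.symm (inv_mul_mem_inv_mul hy hb)
          (inv_mul_mem_inv_mul hp (hA hv)) (by rw [hprod]; exact hz1')
        rw [hprod] at this
        simpa only [or_comm] using this
      · have hprod : (p⁻¹ * p) * (y⁻¹ * y') = ((p * b⁻¹) • y)⁻¹ * ((p * b⁻¹) • y') := by
          simp [mul_assoc]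
        have := exists_list_prod_eq (S := S) hij (inv_mul_mem_inv_mul hp hp)
          (inv_mul_mem_inv_mul hy hy') (by rw [hprod]; exact hz1')
        rwa [hprod] at this
    obtain ⟨m, hm0, hmnd, hmq, rfl⟩ := hm
    rw [List.map_append, List.map_cons, List.nodup_append, List.nodup_cons] at hnd
    obtain ⟨hn1, ⟨hn2, hn3⟩, hn4⟩ := hnd
    have hi1 : ∀ q ∈ l₁, q.1 ≠ i' := fun q hq =>
      hn4 _ (List.mem_map_of_mem hq) _ (by simp)
    have hi2 : ∀ q ∈ l₂, q.1 ≠ i' := fun q hq he =>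
      hn2 (List.mem_map.mpr ⟨q, hq, he⟩)
    -- The index `j` was erased, so the substituted word creates no repetition.
    have hj1 : ∀ q ∈ l₁ ++ (i', (m.map Prod.snd).prod) :: l₂, q.1 ≠ j := by
      intro q hql he
      have := (hq q hql).1
      rw [he] at this
      simp [hij.symm] at this
    have hgen := h (l₁ ++ (m ++ l₂)) (by simp [hm0]) ?_ ?_
    · simpa using hgen
    · rw [List.map_append, List.map_append, List.nodup_append, List.nodup_append]
      refine ⟨hn1, ⟨hmnd, hn3, ?_⟩, ?_⟩
      · intro a ha c hc hac
        obtain ⟨q, hq, rfl⟩ := List.mem_map.mp ha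
        obtain ⟨r, hr, rfl⟩ := List.mem_map.mp hc
        rcases (hmq q hq).1 with h1 | h1
        · exact hi2 r hr (hac ▸ h1)
        · exact hj1 r (by simp [hr]) (hac ▸ h1)
      · intro a ha c hc hac
        obtain ⟨q, hq, rfl⟩ := List.mem_map.mp ha
        rcases List.mem_append.mp hc with hc | hc
        · obtain ⟨r, hr, rfl⟩ := List.mem_map.mp hc
          rcases (hmq r hr).1 with h1 | h1
          · exact hi1 q hq (hac.trans h1)
          · exact hj1 q (by simp [hq]) (hac.trans h1)
        · exact hn4 _ (List.mem_map_of_mem hq) _ (List.mem_cons_of_mem _ hc) hac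
    · intro q hqm
      rcases List.mem_append.mp hqm with hq1 | hqm
      · exact hmem q (hi1 q hq1) (hq q (by simp [hq1]))
      · rcases List.mem_append.mp hqm with hq1 | hq1
        · refine ⟨?_, (hmq q hq1).2⟩
          rcases (hmq q hq1).1 with h1 | h1 <;> rw [h1] <;> simp [hj]
        · exact hmem q (hi2 q hq1) (hq q (by simp [hq1]))
  · exact h l hl hnd fun q hql =>
      hmem q (fun he => hil (he ▸ List.mem_map_of_mem hql)) (hq q hql)

end GenericOn

/-! ### Counting packings -/

section PackingsOn

/-- Coordinate `j` is free in `T`, so prescribing it in terms of the others divides the count by the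
order of `G`. Each merging gains its factor `1/N` this way. -/
theorem ncard_eq_card_mul_of_update_invariant {ι G : Type*} [DecidableEq ι] {T : Set (ι → G)} {j : ι}
    (hT : ∀ g y, Function.update g j y ∈ T ↔ g ∈ T) (f : (ι → G) → G)
    (hf : ∀ g y, f (Function.update g j y) = f g) :
    T.ncard = Nat.card G * {g ∈ T | g j = f g}.ncard := by
  rw [← Nat.card_coe_set_eq, ← Nat.card_coe_set_eq, ← Nat.card_prod]
  refine Nat.card_congr ⟨fun g => (g.1 j, ⟨Function.update g.1 j (f g.1), (hT _ _).mpr g.2, by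
      rw [Function.update_self, hf]⟩), fun q => ⟨Function.update q.2.1 j q.1,
      (hT _ _).mpr q.2.2.1⟩, fun g => ?_, fun q => ?_⟩
  · ext1
    simp
  · obtain ⟨y, g, hgT, hg⟩ := q
    ext1
    · simp
    · ext1
      simp [hf, ← hg]

variable {ι G : Type*} [Group G]

/-- The tuples that are packings of the subfamily of `S` with indices in `V`. -/
def packingsOn (V : Finset ι) (S : ι → Set G) : Set (ι → G) :=
  {g | (V : Set ι).Pairwise fun i j => Disjoint (g i • S i) (g j • S j)}

theorem mem_packingsOn_congr {V : Finset ι} {S S' : ι → Set G} {g g' : ι → G}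
    (hS : ∀ k ∈ V, S' k = S k) (hg : ∀ k ∈ V, g' k = g k) :
    g' ∈ packingsOn V S' ↔ g ∈ packingsOn V S := by
  refine forall₄_congr fun k (hk : k ∈ V) l (hl : l ∈ V) => ?_
  simp only [hS k hk, hS l hl, hg k hk, hg l hl]

variable [DecidableEq ι]

theorem mem_packingsOn_insert {V : Finset ι} {S : ι → Set G} {i : ι} (hi : i ∉ V) (g : ι → G) :
    g ∈ packingsOn (insert i V) S ↔
      g ∈ packingsOn V S ∧ ∀ k ∈ V, Disjoint (g i • S i) (g k • S k) := by
  have : Std.Symm fun i j => Disjoint (g i • S i) (g j • S j) := ⟨fun _ _ h => h.symm⟩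
  rw [packingsOn, Set.mem_ofPred_eq, Finset.coe_insert,
    Set.pairwise_insert_of_symm_of_notMem (by simpa using hi)]
  rfl

theorem mem_packingsOn_insert_update {V : Finset ι} {S : ι → Set G} {i : ι} (hi : i ∉ V)
    (B : Set G) (g : ι → G) :
    g ∈ packingsOn (insert i V) (Function.update S i B) ↔
      g ∈ packingsOn V S ∧ ∀ k ∈ V, Disjoint (g i • B) (g k • S k) := by
  have hS : ∀ k ∈ V, Function.update S i B k = S k := fun k hk =>
    Function.update_of_ne (ne_of_mem_of_not_mem hk hi) _ _
  rw [mem_packingsOn_insert hi, mem_packingsOn_congr hS fun _ _ => rfl, Function.update_self]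
  exact and_congr_right fun _ => forall₂_congr fun k hk => by rw [hS k hk]

/-- The packings in which the point `p` of the set with index `i` coincides with the point `b`
of the set with index `j` are those of the merged family. -/
theorem mem_packingsOn_and_mul_eq_iff {V : Finset ι} {S : ι → Set G} {i j : ι} (hi : i ∉ V)
    (hj : j ∈ V) (h : GenericOn (insert i V) S) {A : Set G} {p b : G} (hA : A ⊆ S i)
    (hp : p ∈ S i) (hpA : p ∉ A) (hb : b ∈ S j) (g : ι → G) :
    (g ∈ packingsOn (insert i (V.erase j)) (Function.update S i (A ∪ (p * b⁻¹) • S j)) ∧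
      g j = g i * p * b⁻¹) ↔
    (g ∈ packingsOn (insert i V) (Function.update S i A) ∧ g i * p = g j * b) := by
  have hij : i ≠ j := fun h => hi (h ▸ hj)
  have heq : g j = g i * p * b⁻¹ ↔ g i * p = g j * b := by
    rw [eq_mul_inv_iff_mul_eq, eq_comm]
  rw [heq]
  refine and_congr_left fun hg => ?_
  rw [← heq] at hg
  have hiV : i ∉ V.erase j := fun h => hi (Finset.mem_of_mem_erase h)
  rw [mem_packingsOn_insert_update hiV, mem_packingsOn_insert_update hi]
  have hsm : g i • (A ∪ (p * b⁻¹) • S j) = g i • A ∪ g j • S j := by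
    rw [Set.smul_set_union, smul_smul, hg, mul_assoc]
  -- This is the only disjointness that the merged family does not impose; genericity provides it.
  have hdisj : Disjoint (g i • A) (g j • S j) := by
    have := h.disjoint (Finset.mem_insert_self i V) (Finset.mem_insert_of_mem hj) hij hA hp hpA hb
    rw [hg, mul_assoc, ← smul_smul]
    exact Set.disjoint_smul_set.mpr this
  rw [hsm]
  simp only [Set.disjoint_union_left]
  have hV : g ∈ packingsOn V S ↔ g ∈ packingsOn (V.erase j) S ∧
      ∀ k ∈ V.erase j, Disjoint (g j • S j) (g k • S k) := by
    rw [← mem_packingsOn_insert (Finset.notMem_erase j V), Finset.insert_erase hj]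
  have hA' : (∀ k ∈ V, Disjoint (g i • A) (g k • S k)) ↔
      ∀ k ∈ V.erase j, Disjoint (g i • A) (g k • S k) := by
    refine ⟨fun H k hk => H k (Finset.mem_of_mem_erase hk), fun H k hk => ?_⟩
    obtain rfl | hkj := eq_or_ne k j
    · exact hdisj
    · exact H k (Finset.mem_erase.mpr ⟨hkj, hk⟩)
  rw [hV, hA']
  simp only [imp_and, forall_and]
  tauto

open Function in
/-- Removing the point `p` from the set with index `i` creates new packings, in which `p` is
covered by exactly one point of one of the other sets. -/
theorem ncard_packingsOn_update [Finite ι] [Finite G] {V : Finset ι} {S : ι → Set G} {i : ι}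
    (hi : i ∉ V) (h : GenericOn (insert i V) S) {A : Set G} {p : G} (hSi : S i = insert p A)
    (hpA : p ∉ A) (C : ι → ℝ)
    (hC : ∀ j ∈ V, ∀ b ∈ S j, ((packingsOn (insert i (V.erase j))
      (update S i (A ∪ (p * b⁻¹) • S j))).ncard : ℝ) = C j) :
    ((packingsOn (insert i V) (update S i A)).ncard : ℝ) =
      (packingsOn (insert i V) S).ncard +
        (Nat.card G : ℝ)⁻¹ * ∑ j ∈ V, ((S j).ncard : ℝ) * C j := by
  classical
  have := Fintype.ofFinite ι
  have := Fintype.ofFinite G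
  have hA : A ⊆ S i := hSi ▸ Set.subset_insert p A
  have hp : p ∈ S i := hSi ▸ Set.mem_insert p A
  set P := packingsOn (insert i V) (update S i A) with hP
  -- Restoring `p` adds only the condition that its translate be uncovered.
  have hSmem : ∀ g, g ∈ packingsOn (insert i V) S ↔
      g ∈ P ∧ ∀ k ∈ V, g i * p ∉ g k • S k := by
    intro g
    rw [hP, mem_packingsOn_insert hi, mem_packingsOn_insert_update hi, hSi, and_assoc,
      ← forall₂_and]
    refine and_congr_right fun _ => forall₂_congr fun k _ => ?_
    rw [← Set.image_smul, Set.image_insert_eq, Set.disjoint_insert_left, and_comm, Set.image_smul,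
      smul_eq_mul]
  set I := V.sigma fun j => (S j).toFinset with hI
  set F : (Σ _ : ι, G) → Finset (ι → G) := fun q =>
    Finset.univ.filter fun g => g ∈ P ∧ g i * p = g q.1 * q.2 with hF
  have hunion : P.toFinset = (packingsOn (insert i V) S).toFinset ∪ I.biUnion F := by
    ext g
    simp only [Set.mem_toFinset, Finset.mem_union, Finset.mem_biUnion, hSmem, hI, hF,
      Finset.mem_sigma, Finset.mem_filter, Finset.mem_univ, true_and]
    constructor
    · intro hg
      by_cases hk : ∀ k ∈ V, g i * p ∉ g k • S k
      · exact Or.inl ⟨hg, hk⟩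
      · push Not at hk
        obtain ⟨k, hkV, b, hb, hbe⟩ := hk
        exact Or.inr ⟨⟨k, b⟩, ⟨hkV, hb⟩, hg, hbe.symm⟩
    · rintro (hg | ⟨q, -, hg⟩)
      · exact hg.1
      · exact hg.1
  have hdisj : Disjoint (packingsOn (insert i V) S).toFinset (I.biUnion F) := by
    rw [Finset.disjoint_left]
    intro g hg hg'
    simp only [Set.mem_toFinset, Finset.mem_biUnion, hSmem, hI, hF,
      Finset.mem_sigma, Finset.mem_filter, Finset.mem_univ, true_and] at hg hg'
    obtain ⟨q, ⟨hq1, hq2⟩, -, hq3⟩ := hg'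
    exact hg.2 q.1 hq1 ⟨q.2, hq2, hq3.symm⟩
  -- The covering point is unique: cancellation settles equal indices, disjointness of the
  -- translates distinct ones.
  have hpair : (I : Set (Σ _ : ι, G)).PairwiseDisjoint F := by
    rintro ⟨j, b⟩ hjb ⟨j', b'⟩ hjb' hne
    rw [Function.onFun, Finset.disjoint_left]
    intro g hg hg'
    simp only [hF, Finset.mem_filter, Finset.mem_univ, true_and] at hg hg'
    simp only [hI, Finset.mem_coe, Finset.mem_sigma, Set.mem_toFinset] at hjb hjb'
    have he : g j * b = g j' * b' := hg.2.symm.trans hg'.2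
    obtain rfl | hjj := eq_or_ne j j'
    · exact hne (by rw [mul_left_cancel he])
    · have hgV := ((mem_packingsOn_insert_update hi A g).mp hg.1).1
      exact Set.disjoint_left.mp (hgV hjb.1 hjb'.1 hjj) ⟨b, hjb.2, rfl⟩ ⟨b', hjb'.2, he.symm⟩
  have hFcard : ∀ q ∈ I, ((F q).card : ℝ) = (Nat.card G : ℝ)⁻¹ * C q.1 := by
    rintro ⟨j, b⟩ hq
    simp only [hI, Finset.mem_sigma, Set.mem_toFinset] at hq
    obtain ⟨hj, hb⟩ := hq
    have hij : i ≠ j := fun h => hi (h ▸ hj)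
    have hcard := ncard_eq_card_mul_of_update_invariant (j := j)
      (T := packingsOn (insert i (V.erase j)) (update S i (A ∪ (p * b⁻¹) • S j)))
      (fun g y => mem_packingsOn_congr (fun _ _ => rfl) fun k hk => update_of_ne (by
        rintro rfl
        simp [hij.symm] at hk) _ _)
      (fun g => g i * p * b⁻¹) (fun g y => by rw [update_of_ne hij])
    have hset : {g ∈ packingsOn (insert i (V.erase j)) (update S i (A ∪ (p * b⁻¹) • S j)) |
        g j = g i * p * b⁻¹} = (F ⟨j, b⟩ : Set (ι → G)) := by
      ext g
      simp only [hF, Finset.coe_filter, Finset.mem_univ, true_and]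
      exact mem_packingsOn_and_mul_eq_iff hi hj h hA hp hpA hb g
    rw [hset, Set.ncard_coe_finset] at hcard
    rw [← hC j hj b hb, hcard, Nat.cast_mul, inv_mul_cancel_left₀]
    exact Nat.cast_ne_zero.mpr Nat.card_pos.ne'
  rw [Set.ncard_eq_toFinset_card', hunion, Finset.card_union_of_disjoint hdisj,
    Finset.card_biUnion hpair, Nat.cast_add, Nat.cast_sum, Finset.sum_congr rfl hFcard,
    ← Finset.mul_sum, hI, Finset.sum_sigma, Set.ncard_eq_toFinset_card']
  congr 2
  refine Finset.sum_congr rfl fun j _ => ?_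
  rw [Finset.sum_const (C j), nsmul_eq_mul, Set.ncard_eq_toFinset_card']

open Function in
/-- The number of packings of a generic family depends only on the sizes of the sets. -/
theorem ncard_packingsOn [Fintype ι] [Finite G] (V : Finset ι) (S : ι → Set G)
    (h : GenericOn V S) :
    ((packingsOn V S).ncard : ℝ) = (Nat.card G : ℝ) ^ Fintype.card ι *
      packingSum (fun k => ((S k).ncard : ℝ)) (Nat.card G : ℝ)⁻¹ V := by
  induction hn : V.card generalizing V S with
  | zero =>
    obtain rfl := Finset.card_eq_zero.mp hn
    -- Coordinates outside `V` are free, whence the exponent `Fintype.card ι` in place of `V.card`.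
    have huniv : packingsOn (∅ : Finset ι) S = Set.univ := by
      ext g
      simp [packingsOn]
    rw [huniv, Set.ncard_univ, packingSum, partitionSum_empty, Nat.card_fun,
      Nat.card_eq_fintype_card (α := ι)]
    simp
  | succ n ih =>
    obtain ⟨i, V, hi, rfl, hV⟩ := Finset.card_eq_succ.mp hn
    have hupd : ∀ (S : ι → Set G) (B : Set G), (fun k => ((update S i B k).ncard : ℝ)) =
        update (fun k => ((S k).ncard : ℝ)) i (B.ncard : ℝ) := by
      intro S B
      ext k
      obtain rfl | hk := eq_or_ne k i
      · simp
      · simp [hk]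
    -- The inner induction removes points of `S i` down to the empty set, which imposes no
    -- condition. Merged families have larger sets but one index fewer, so the outer hypothesis
    -- covers them.
    induction hk : (S i).ncard generalizing S with
    | zero =>
      have hSi : S i = ∅ := (Set.ncard_eq_zero).mp hk
      have hset : packingsOn (insert i V) S = packingsOn V S := by
        ext g
        rw [mem_packingsOn_insert hi, hSi]
        simp
      rw [hset, packingSum_insert_of_eq_zero _ hi (by simp [hk])]
      exact ih V S (h.mono (Finset.subset_insert i V) fun _ _ => subset_rfl) hV
    | succ c ihc =>
      obtain ⟨p, A, hpA, hSi, hAc⟩ := (Set.ncard_eq_succ).mp hk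
      have hA : A ⊆ S i := hSi ▸ Set.subset_insert p A
      have hp : p ∈ S i := hSi ▸ Set.mem_insert p A
      have hgenA : GenericOn (insert i V) (update S i A) := h.mono subset_rfl fun k _ => by
        obtain rfl | hk := eq_or_ne k i
        · simpa using hA
        · simp [hk]
      have h1 := ihc (update S i A) hgenA (by simpa using hAc)
      have h2 := ncard_packingsOn_update hi h hSi.symm hpA
        (fun j => (Nat.card G : ℝ) ^ Fintype.card ι * packingSum
          (update (fun k => ((S k).ncard : ℝ)) i (c + ((S j).ncard : ℝ))) (Nat.card G : ℝ)⁻¹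
            (insert i (V.erase j))) ?_
      · rw [h1, hupd, hAc] at h2
        rw [packingSum_insert_succ (fun k => ((S k).ncard : ℝ)) _ (c : ℝ) hi (by simp [hk])]
        have hsum : ∑ j ∈ V, ((S j).ncard : ℝ) * ((Nat.card G : ℝ) ^ Fintype.card ι * packingSum
            (update (fun k => ((S k).ncard : ℝ)) i (c + ((S j).ncard : ℝ))) (Nat.card G : ℝ)⁻¹
              (insert i (V.erase j))) =
            (Nat.card G : ℝ) ^ Fintype.card ι * ∑ j ∈ V, ((S j).ncard : ℝ) * packingSum
            (update (fun k => ((S k).ncard : ℝ)) i (c + ((S j).ncard : ℝ))) (Nat.card G : ℝ)⁻¹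
              (insert i (V.erase j)) := by
          rw [Finset.mul_sum]
          exact Finset.sum_congr rfl fun j _ => by ring
        rw [hsum] at h2
        linear_combination -h2
      · intro j hj b hb
        have hij : i ≠ j := fun h => hi (h ▸ hj)
        rw [ih _ _ (h.merge hi hj hA hp hb), hupd, Set.ncard_union_eq
          (h.disjoint (Finset.mem_insert_self i V) (Finset.mem_insert_of_mem hj) hij hA hp hpA hb),
          hAc, Set.ncard_smul_set]
        · push_cast
          rfl
        · rw [Finset.card_insert_of_notMem fun h => hi (Finset.mem_of_mem_erase h),
            Finset.card_erase_of_mem hj, hV]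
          have := Finset.card_pos.mpr ⟨j, hj⟩
          omega

end PackingsOn

/-! ### Conclusion for the original definitions -/

theorem IsGeneric.genericOn {G : Type*} [Group G] {n : ℕ} {S : Fin n → Set G} (h : IsGeneric S) :
    GenericOn Finset.univ S := by
  intro l hl hnd hq
  have hprod := h l.length (List.length_pos_iff.mpr hl) (fun j => l[j].1) (fun j k hjk => ?_)
    (fun j => l[j].2) fun j => (hq _ (List.getElem_mem _)).2
  · have hlist : List.ofFn (fun j : Fin l.length => l[j].2) = l.map Prod.snd :=
      List.ext_getElem (by simp) (by simp)
    rwa [hlist] at hprod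
  · refine Fin.ext ((List.Nodup.getElem_inj_iff hnd (hi := by simp) (hj := by simp)).mp ?_)
    simpa using hjk

theorem packings_eq_packingsOn {G : Type*} [Group G] {n : ℕ} (S : Fin n → Set G) :
    packings S = packingsOn Finset.univ S := by
  ext g
  simp [packings, packingsOn, Set.pairwise_univ]

theorem proposition2p2 :
    ∃ U : PowerSeries SigmaRing,
      (∀ (G : Type*) [Group G] [Finite G] (n : ℕ) (S : Fin n → Set G),
        (∀ i, (S i).Nonempty) → IsGeneric S →
          ∃ u : ℝ,
            HasSum (fun m : ℕ =>
              ((MvPolynomial.eval (sigmaOf S) (PowerSeries.coeff m U) : ℤ) : ℝ)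
                * ((Nat.card G : ℝ)⁻¹) ^ m) u ∧
            ((packings S).ncard : ℝ) = (Nat.card G : ℝ) ^ n * u) ∧
      ∀ m : ℕ, 1 ≤ m →
        MvPolynomial.weightedTotalDegree (fun i : ℕ+ => (i : ℕ)) (PowerSeries.coeff m U) ≤ 2 * m ∧
        PowerSeries.coeff m U ∈
          Ideal.span {p : SigmaRing | ∃ i : ℕ+, m + 1 ≤ (i : ℕ) ∧ (i : ℕ) ≤ 2 * m ∧
            p = MvPolynomial.X i} := by
  choose p hp hp' using exists_packing_polynomial
  refine ⟨PowerSeries.mk p, fun G _ _ n S _ hS => ?_, fun m hm => ?_⟩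
  · refine ⟨packingSum (fun k => ((S k).ncard : ℝ)) (Nat.card G : ℝ)⁻¹ Finset.univ, ?_, ?_⟩
    · have := hasSum_packingCoeff (fun k => ((S k).ncard : ℤ)) Finset.univ (Nat.card G : ℝ)⁻¹
      simp only [Int.cast_natCast] at this
      refine this.congr_fun ?_
      intro m
      rw [PowerSeries.coeff_mk, ← hp m n]
      rfl
    · rw [packings_eq_packingsOn, ncard_packingsOn _ _ hS.genericOn, Fintype.card_fin]
  · rw [PowerSeries.coeff_mk]
    exact hp' m hm
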